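/- Let $n\ge 1$ and $d=2^n$. A Pauli channel on $n$ qubits is a map $\mathcal P_p(\rho)=\sum_{P\in\{I,X,Y,Z\}^{\otimes n}}p(P)\,P\rho P$ with $p$ a probability distribution on the $d^2$ Pauli operators. For a linear map $\Phi$ on $\mathbb C^{d\times d}$ let $\|\Phi\|_\diamond=\max_{\langle\phi|\phi\rangle=1}\|(\mathrm{id}_d\otimes\Phi)(|\phi\rangle\langle\phi|)\|_1$, where $\phi\in\mathbb C^d\otimes\mathbb C^d$. An adaptive incoherent (ancilla-free) strategy with $N$ measurements for learning an unknown Pauli channel $\mathcal P$ proceeds in steps $t=1,\dots,N$. At step $t$ the learner chooses an $n$-qubit state $\rho_t$, a number $m_t\ge 1$ of channel uses, unital quantum channels $\mathcal N_1,\dots,\mathcal N_{m_t-1}$ on $n$ qubits, and an $n$-qubit POVM $\{M^t_i\}_i$ with finitely many elements, and observes outcome $i$ with probability $$\mathrm{tr}\big(M^t_i\;\mathcal P\circ\mathcal N_{m_t-1}\circ\mathcal P\circ\cdots\circ\mathcal P\circ\mathcal N_1\circ\mathcal P(\rho_t)\big).$$ All these choices, including $m_t$, may depend on the outcomes of the previous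 steps and on an internal random seed. After step $N$ the learner outputs a Pauli channel $\tilde{\mathcal P}$ depending on all outcomes and on the seed. The strategy is $1/3$-correct at precision $\varepsilon$ if, for every Pauli channel $\mathcal P$, it outputs $\tilde{\mathcal P}$ with $\|\mathcal P-\tilde{\mathcal P}\|_\diamond\le\varepsilon$ with probability at least $2/3$. Theorem. There is a universal constant $c>0$ such that for all $n\ge1$ and all $0<\varepsilon\le 1/4$, every adaptive incoherent strategy that is $1/3$-correct at precision $\varepsilon$ uses $$N\ \ge\ c\,\frac{d^2}{\varepsilon^2}$$ measurements. In particular the bound does not depend on the numbers $m_t$ of channel uses. -/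

import Mathlib

open MeasureTheory
open scoped Matrix ComplexOrder MatrixOrder

namespace PauliTomography

/-- Labels of the computational basis of `n` qubits; the dimension is `d = 2 ^ n`. -/
abbrev Qubits (n : ℕ) : Type := Fin n → Fin 2

/-- The `d × d` complex matrices. -/
abbrev Op (n : ℕ) : Type := Matrix (Qubits n) (Qubits n) ℂ

/-- The one-qubit Pauli matrices `I, X, Y, Z`. -/
noncomputable def pauli : Fin 4 → Matrix (Fin 2) (Fin 2) ℂ :=
  ![1, !![0, 1; 1, 0], !![0, -Complex.I; Complex.I, 0], !![1, 0; 0, -1]]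

/-- Labels of the `4 ^ n` Pauli operators on `n` qubits. -/
abbrev PauliLabel (n : ℕ) : Type := Fin n → Fin 4

/-- The Pauli operator `pauli (s 0) ⊗ ⋯ ⊗ pauli (s (n - 1))`. -/
noncomputable def pauliOp {n : ℕ} (s : PauliLabel n) : Op n :=
  Matrix.of fun i j => ∏ k, pauli (s k) (i k) (j k)

/-- Probability distributions on the Pauli operators. -/
abbrev PauliDist (n : ℕ) : Type := ↥(stdSimplex ℝ (PauliLabel n))

/-- The Pauli channel `ρ ↦ ∑ P, p(P) P ρ P`. -/
noncomputable def pauliChannel {n : ℕ} (p : PauliDist n) : Op n →ₗ[ℂ] Op n :=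
  ∑ s, ((p.1 s : ℝ) : ℂ) •
    (LinearMap.mulLeft ℂ (pauliOp s) ∘ₗ LinearMap.mulRight ℂ (pauliOp s))

/-- Quantum channels, in Kraus form. -/
def IsQuantumChannel {n : ℕ} (Φ : Op n →ₗ[ℂ] Op n) : Prop :=
  ∃ (r : ℕ) (A : Fin r → Op n), ∑ k, (A k)ᴴ * A k = 1 ∧
    ∀ ρ, Φ ρ = ∑ k, A k * ρ * (A k)ᴴ

/-- Unital quantum channels. -/
structure UnitalChannel (n : ℕ) where
  toMap : Op n →ₗ[ℂ] Op n
  isQuantumChannel : IsQuantumChannel toMap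
  map_one : toMap 1 = 1

/-- Quantum states (density matrices). -/
structure QState (n : ℕ) where
  mat : Op n
  posSemidef : mat.PosSemidef
  trace_eq_one : mat.trace = 1

/-- Measurements (POVMs) on `n` qubits with outcomes in `Fin K`; effects may be zero. -/
structure POVM (n K : ℕ) where
  effect : Fin K → Op n
  posSemidef : ∀ i, (effect i).PosSemidef
  sum_eq_one : ∑ i, effect i = 1

/-- The Schatten 1-norm `tr √(M† M)`. -/
noncomputable def traceNorm {ι : Type*} [Fintype ι] [DecidableEq ι] (M : Matrix ι ι ℂ) : ℝ :=
  (CFC.sqrt (Mᴴ * M)).trace.re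

/-- The map `id ⊗ Φ` on operators on `ℂ ^ d ⊗ ℂ ^ d`: `Φ` is applied to each block. -/
def idTensor {n : ℕ} (Φ : Op n →ₗ[ℂ] Op n)
    (X : Matrix (Qubits n × Qubits n) (Qubits n × Qubits n) ℂ) :
    Matrix (Qubits n × Qubits n) (Qubits n × Qubits n) ℂ :=
  Matrix.of fun a b => Φ (Matrix.of fun i j => X (a.1, i) (b.1, j)) a.2 b.2

/-- The diamond norm: the supremum of `‖(id ⊗ Φ)(|φ⟩⟨φ|)‖₁` over all unit vectors `φ`. It is
finite; the extended codomain only avoids a convention for unbounded suprema. -/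
noncomputable def diamondNorm {n : ℕ} (Φ : Op n →ₗ[ℂ] Op n) : ENNReal :=
  ⨆ (φ : Qubits n × Qubits n → ℂ) (_ : star φ ⬝ᵥ φ = 1),
    ENNReal.ofReal (traceNorm (idTensor Φ (Matrix.vecMulVec φ (star φ))))

/-- One step of an ancilla-free learner: an input state, the list `𝒩₁, …, 𝒩ₘ₋₁` (of any length)
of unital channels applied in between `m` uses of the unknown channel, and a measurement. -/
structure Step (n K : ℕ) where
  input : QState n
  between : List (UnitalChannel n)
  measurement : POVM n K

/-- The state `(Φ ∘ 𝒩ₘ₋₁ ∘ Φ ∘ ⋯ ∘ Φ ∘ 𝒩₁ ∘ Φ)(ρ)` that is measured when the unknown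
channel is `Φ`. -/
noncomputable def Step.output {n K : ℕ} (a : Step n K) (Φ : Op n →ₗ[ℂ] Op n) : Op n :=
  a.between.foldl (fun σ 𝒩 => Φ (𝒩.toMap σ)) (Φ a.input.mat)

/-- The probability of outcome `i`, by Born's rule. -/
noncomputable def Step.prob {n K : ℕ} (a : Step n K) (Φ : Op n →ₗ[ℂ] Op n) (i : Fin K) : ℝ :=
  (a.output Φ * a.measurement.effect i).trace.re

/-- An adaptive ancilla-free strategy with `N` measurements. Every choice at step `t`, including
the number of channel uses, may depend on the outcomes of the earlier steps; the estimated Pauli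
channel may depend on all outcomes. `K` is any common bound on the numbers of outcomes. -/
structure Strategy (n N : ℕ) where
  K : ℕ
  step : (t : Fin N) → (Fin t → Fin K) → Step n K
  estimate : (Fin N → Fin K) → PauliDist n

/-- The outcomes observed before step `t`. -/
def before {N K : ℕ} (i : Fin N → Fin K) (t : Fin N) : Fin t → Fin K :=
  fun u => i ⟨u, u.2.trans t.2⟩

/-- The probability of the sequence of outcomes `i` when the unknown Pauli channel is `p`. -/
noncomputable def Strategy.prob {n N : ℕ} (S : Strategy n N) (p : PauliDist n)
    (i : Fin N → Fin S.K) : ℝ :=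
  ∏ t, (S.step t (before i t)).prob (pauliChannel p) (i t)

open Classical in
/-- The probability that the estimate is `ε`-close to the unknown channel in diamond norm. -/
noncomputable def Strategy.successProb {n N : ℕ} (S : Strategy n N) (ε : ℝ) (p : PauliDist n) :
    ℝ :=
  ∑ i : Fin N → Fin S.K,
    if diamondNorm (pauliChannel p - pauliChannel (S.estimate i)) ≤ ENNReal.ofReal ε then
      S.prob p i else 0

/-- A strategy whose choices may also depend on an internal random seed `ω` with law `μ` is
`1/3`-correct at precision `ε`: for every Pauli channel it succeeds with probability at least
`2/3`. (A deterministic strategy is a constant family.) -/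
def IsOneThirdCorrect {Ω : Type*} [MeasurableSpace Ω] (μ : Measure Ω) {n N : ℕ}
    (S : Ω → Strategy n N) (ε : ℝ) : Prop :=
  ∀ p : PauliDist n, (2 / 3 : ENNReal) ≤ ∫⁻ ω, ENNReal.ofReal ((S ω).successProb ε p) ∂μ

end PauliTomography

/-!
The unknown channel is taken from a family of `2 ^ m` Pauli channels, `m = 4 ^ n / 2`: the Pauli
operators are grouped into `m` pairs, and in each pair one operator has weight `(1 + 4ε) / 4 ^ n`
and the other `(1 - 4ε) / 4 ^ n`, as prescribed by a bit (`hardDist`).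

*A measurement reveals little.* The state that is measured is the image of some state under a last
use of the unknown channel (`Step.exists_output_eq`). Since the sum of `P σ P` over all Pauli
operators is `2 ^ n • 1` for every state `σ`, and each term is positive, the output of a channel in
the family lies between `(1 ± 4ε)` times the maximally mixed state, so each outcome probability is
within a factor `1 ± 4ε` of a reference probability that does not depend on the channel
(`Step.abs_prob_sub_mixedProb_le`). This holds whatever precedes the last use, which is why the
number of channel uses plays no role. Hence the likelihood ratio of all `N` outcomes against the
reference law has second moment at most `(1 + 16ε²) ^ N` (`Strategy.sum_prob_sq_div_le`).

*A blind guess fails.* Testing on the maximally entangled state shows that the diamond distance of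
two Pauli channels is at least the `ℓ¹` distance of their weights
(`ofReal_sum_abs_sub_le_diamondNorm`), so an estimate within `ε` recovers at least three quarters of
the `m` bits (`card_ne_mul_le_sum_abs`). A fixed estimate does so for a fraction of at most
`b = 4 ^ ⌊m / 4⌋ (5 / 8) ^ m` of the family (`card_hamming_le`).

By the Cauchy-Schwarz inequality, the squared average success probability is at most
`(1 + 16ε²) ^ N * b` (`Strategy.sq_sum_successProb_le`). It is at least `4 / 9`, whereas
`b ≤ (4 / 9) exp (-m / 100)`; so `16 ε² N ≥ m / 100`.
-/

namespace PauliTomography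

/-! ### Pauli operators -/

lemma star_pauli_apply (a : Fin 4) (i j : Fin 2) : star (pauli a i j) = pauli a j i := by
  fin_cases a <;> fin_cases i <;> fin_cases j <;> simp [pauli]

lemma sum_pauli_mul_pauli_apply (a : Fin 4) (i j : Fin 2) :
    ∑ k, pauli a i k * pauli a k j = if i = j then 1 else 0 := by
  fin_cases a <;> fin_cases i <;> fin_cases j <;> simp [pauli]

lemma sum_pauli_apply_mul_pauli_apply (i j k l : Fin 2) :
    ∑ a, pauli a i j * pauli a k l = if i = l ∧ j = k then 2 else 0 := by
  fin_cases i <;> fin_cases j <;> fin_cases k <;> fin_cases l <;>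
    simp [pauli, Fin.sum_univ_four] <;> norm_num

lemma sum_star_pauli_mul_pauli (a b : Fin 4) :
    ∑ i, ∑ j, star (pauli a i j) * pauli b i j = if a = b then 2 else 0 := by
  fin_cases a <;> fin_cases b <;> simp [pauli] <;> norm_num

/-- Distributivity, in the form used to reduce identities for tensor products to one factor. -/
lemma sum_prod_apply {n : ℕ} {β R : Type*} [Fintype β] [CommSemiring R] (f : Fin n → β → R) :
    ∑ s : Fin n → β, ∏ k, f k (s k) = ∏ k, ∑ b, f k b := by
  classical
  rw [Finset.prod_univ_sum, Fintype.piFinset_univ]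

lemma isHermitian_pauliOp {n : ℕ} (s : PauliLabel n) : (pauliOp s)ᴴ = pauliOp s := by
  ext i j
  simp only [Matrix.conjTranspose_apply, pauliOp, Matrix.of_apply, star_prod, star_pauli_apply]

lemma pauliOp_mul_self {n : ℕ} (s : PauliLabel n) : pauliOp s * pauliOp s = 1 := by
  ext i j
  simp only [Matrix.mul_apply, pauliOp, Matrix.of_apply, ← Finset.prod_mul_distrib]
  rw [sum_prod_apply (fun k b => pauli (s k) (i k) b * pauli (s k) b (j k))]
  simp only [sum_pauli_mul_pauli_apply, Finset.prod_ite_zero, Matrix.one_apply, funext_iff]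
  simp

lemma sum_pauliOp_apply_mul_pauliOp_apply {n : ℕ} (i j k l : Qubits n) :
    ∑ s, pauliOp s i j * pauliOp s k l = if i = l ∧ j = k then 2 ^ n else 0 := by
  simp only [pauliOp, Matrix.of_apply, ← Finset.prod_mul_distrib]
  rw [sum_prod_apply (fun q a => pauli a (i q) (j q) * pauli a (k q) (l q))]
  simp only [sum_pauli_apply_mul_pauli_apply, Finset.prod_ite_zero, funext_iff]
  simp [forall_and]

lemma sum_star_pauliOp_mul_pauliOp {n : ℕ} (s t : PauliLabel n) :
    ∑ i, ∑ j, star (pauliOp s i j) * pauliOp t i j = if s = t then 2 ^ n else 0 := by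
  simp only [pauliOp, Matrix.of_apply, star_prod, ← Finset.prod_mul_distrib]
  have h : ∀ i : Qubits n,
      ∑ j : Qubits n, ∏ k, star (pauli (s k) (i k) (j k)) * pauli (t k) (i k) (j k) =
        ∏ k, ∑ b, star (pauli (s k) (i k) b) * pauli (t k) (i k) b := fun i =>
    sum_prod_apply (fun k b => star (pauli (s k) (i k) b) * pauli (t k) (i k) b)
  simp only [h]
  rw [sum_prod_apply (fun k a => ∑ b, star (pauli (s k) a b) * pauli (t k) a b)]
  simp only [sum_star_pauli_mul_pauli, Finset.prod_ite_zero, funext_iff]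
  simp

/-- Twirling over all Pauli operators is completely depolarizing. -/
lemma sum_pauliOp_mul_mul_pauliOp {n : ℕ} (σ : Op n) :
    ∑ s, pauliOp s * σ * pauliOp s = ((2 : ℂ) ^ n * σ.trace) • (1 : Op n) := by
  ext i l
  simp only [Matrix.sum_apply, Matrix.mul_apply, Finset.sum_mul, Matrix.smul_apply, smul_eq_mul]
  rw [Finset.sum_comm]
  have h : ∀ k : Qubits n, ∑ s : PauliLabel n, ∑ j, pauliOp s i j * σ j k * pauliOp s k l =
      if i = l then 2 ^ n * σ k k else 0 := by
    intro k
    rw [Finset.sum_comm]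
    have h' : ∀ j : Qubits n, ∑ s : PauliLabel n, pauliOp s i j * σ j k * pauliOp s k l =
        (if i = l ∧ j = k then 2 ^ n else 0) * σ j k := by
      intro j
      rw [← sum_pauliOp_apply_mul_pauliOp_apply, Finset.sum_mul]
      exact Finset.sum_congr rfl fun s _ => by ring
    simp only [h']
    by_cases hil : i = l <;> simp [hil]
  simp only [h]
  by_cases hil : i = l
  · subst hil
    simp [Matrix.trace, Finset.mul_sum]
  · simp [hil]

/-! ### Pauli channels and measurement probabilities -/

lemma pauliChannel_apply {n : ℕ} (p : PauliDist n) (σ : Op n) :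
    pauliChannel p σ = ∑ s, ((p.1 s : ℝ) : ℂ) • (pauliOp s * σ * pauliOp s) := by
  simp [pauliChannel, LinearMap.sum_apply, mul_assoc]

lemma posSemidef_pauliOp_mul_mul {n : ℕ} {σ : Op n} (hσ : σ.PosSemidef) (s : PauliLabel n) :
    (pauliOp s * σ * pauliOp s).PosSemidef := by
  have h := hσ.mul_mul_conjTranspose_same (pauliOp s)
  rwa [isHermitian_pauliOp] at h

lemma posSemidef_pauliChannel {n : ℕ} (p : PauliDist n) {σ : Op n} (hσ : σ.PosSemidef) :
    (pauliChannel p σ).PosSemidef := by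
  rw [pauliChannel_apply]
  refine Matrix.posSemidef_sum _ fun s _ => (posSemidef_pauliOp_mul_mul hσ s).smul ?_
  exact_mod_cast p.2.1 s

lemma trace_pauliChannel {n : ℕ} (p : PauliDist n) (σ : Op n) :
    (pauliChannel p σ).trace = σ.trace := by
  have h : ∀ s : PauliLabel n, (pauliOp s * σ * pauliOp s).trace = σ.trace := fun s => by
    rw [Matrix.trace_mul_comm, ← mul_assoc, pauliOp_mul_self, one_mul]
  rw [pauliChannel_apply, Matrix.trace_sum]
  simp only [Matrix.trace_smul, h, smul_eq_mul]
  rw [← Finset.sum_mul, ← Complex.ofReal_sum, p.2.2, Complex.ofReal_one, one_mul]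

lemma IsQuantumChannel.posSemidef {n : ℕ} {Φ : Op n →ₗ[ℂ] Op n} (hΦ : IsQuantumChannel Φ)
    {σ : Op n} (hσ : σ.PosSemidef) : (Φ σ).PosSemidef := by
  obtain ⟨r, A, -, hA⟩ := hΦ
  rw [hA]
  exact Matrix.posSemidef_sum _ fun k _ => hσ.mul_mul_conjTranspose_same (A k)

lemma IsQuantumChannel.trace_map {n : ℕ} {Φ : Op n →ₗ[ℂ] Op n} (hΦ : IsQuantumChannel Φ)
    (σ : Op n) : (Φ σ).trace = σ.trace := by
  obtain ⟨r, A, hA1, hA⟩ := hΦ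
  rw [hA, Matrix.trace_sum]
  calc ∑ k, (A k * σ * (A k)ᴴ).trace = ∑ k, ((A k)ᴴ * A k * σ).trace :=
        Finset.sum_congr rfl fun k _ => by rw [Matrix.trace_mul_comm, mul_assoc]
    _ = σ.trace := by rw [← Matrix.trace_sum, ← Finset.sum_mul, hA1, one_mul]

/-- Whatever happens before it, the last operation ahead of the measurement is a use of the
unknown channel on some quantum state. -/
lemma Step.exists_output_eq {n K : ℕ} (a : Step n K) (p : PauliDist n) :
    ∃ σ : Op n, σ.PosSemidef ∧ σ.trace = 1 ∧
      a.output (pauliChannel p) = pauliChannel p σ := by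
  have h : ∀ (l : List (UnitalChannel n)) (ρ : Op n), ρ.PosSemidef → ρ.trace = 1 →
      ∃ σ : Op n, σ.PosSemidef ∧ σ.trace = 1 ∧
        l.foldl (fun σ 𝒩 => pauliChannel p (𝒩.toMap σ)) (pauliChannel p ρ) =
          pauliChannel p σ := by
    intro l
    induction l with
    | nil => exact fun ρ h1 h2 => ⟨ρ, h1, h2, rfl⟩
    | cons 𝒩 l ih =>
      intro ρ h1 h2
      refine ih (𝒩.toMap (pauliChannel p ρ)) ?_ ?_
      · exact 𝒩.isQuantumChannel.posSemidef (posSemidef_pauliChannel p h1)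
      · rw [𝒩.isQuantumChannel.trace_map, trace_pauliChannel, h2]
  exact h a.between a.input.mat a.input.posSemidef a.input.trace_eq_one

lemma trace_mul_re_nonneg {n : ℕ} {A B : Op n} (hA : A.PosSemidef) (hB : B.PosSemidef) :
    0 ≤ (A * B).trace.re := by
  obtain ⟨C, rfl⟩ := CStarAlgebra.nonneg_iff_eq_star_mul_self.mp hB.nonneg
  rw [Matrix.star_eq_conjTranspose, ← mul_assoc, Matrix.trace_mul_comm, ← mul_assoc]
  exact (Complex.nonneg_iff.mp (hA.mul_mul_conjTranspose_same C).trace_nonneg).1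

/-- The outcome distribution of a measurement of the maximally mixed state. -/
noncomputable def POVM.mixedProb {n K : ℕ} (M : POVM n K) (i : Fin K) : ℝ :=
  (M.effect i).trace.re / 2 ^ n

lemma POVM.mixedProb_nonneg {n K : ℕ} (M : POVM n K) (i : Fin K) : 0 ≤ M.mixedProb i :=
  div_nonneg (Complex.nonneg_iff.mp (M.posSemidef i).trace_nonneg).1 (by positivity)

lemma POVM.sum_mixedProb {n K : ℕ} (M : POVM n K) : ∑ i, M.mixedProb i = 1 := by
  simp only [POVM.mixedProb]
  rw [← Finset.sum_div, ← Complex.re_sum, ← Matrix.trace_sum, M.sum_eq_one, Matrix.trace_one]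
  have h : ((2 : ℂ) ^ n) = (((2 : ℝ) ^ n : ℝ) : ℂ) := by push_cast; rfl
  simp [h, -Complex.ofReal_pow]

lemma Step.prob_nonneg {n K : ℕ} (a : Step n K) (p : PauliDist n) (i : Fin K) :
    0 ≤ a.prob (pauliChannel p) i := by
  obtain ⟨σ, hσ, -, h⟩ := a.exists_output_eq p
  rw [Step.prob, h]
  exact trace_mul_re_nonneg (posSemidef_pauliChannel p hσ) (a.measurement.posSemidef i)

lemma Step.sum_prob {n K : ℕ} (a : Step n K) (p : PauliDist n) :
    ∑ i, a.prob (pauliChannel p) i = 1 := by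
  obtain ⟨σ, -, hσ, h⟩ := a.exists_output_eq p
  simp only [Step.prob, h]
  rw [← Complex.re_sum, ← Matrix.trace_sum, ← Finset.mul_sum, a.measurement.sum_eq_one, mul_one,
    trace_pauliChannel, hσ, Complex.one_re]

/-- If all weights of `p` are within a factor `1 ± δ` of the uniform weight, then so are the
outcome probabilities, relative to those of the maximally mixed state. -/
lemma Step.abs_prob_sub_mixedProb_le {n K : ℕ} (a : Step n K) (p : PauliDist n) {δ : ℝ}
    (hp : ∀ s, |p.1 s - 1 / 4 ^ n| ≤ δ / 4 ^ n) (i : Fin K) :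
    |a.prob (pauliChannel p) i - a.measurement.mixedProb i| ≤ δ * a.measurement.mixedProb i := by
  obtain ⟨σ, hσ, hσ1, h⟩ := a.exists_output_eq p
  set M := a.measurement.effect i with hM
  set w : PauliLabel n → ℝ := fun s => (pauliOp s * σ * pauliOp s * M).trace.re with hw
  have hw0 : ∀ s, 0 ≤ w s := fun s =>
    trace_mul_re_nonneg (posSemidef_pauliOp_mul_mul hσ s) (a.measurement.posSemidef i)
  have h4 : (4 : ℝ) ^ n = 2 ^ n * 2 ^ n := by rw [← mul_pow]; norm_num
  have hsum : ∑ s, w s = 2 ^ n * M.trace.re := by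
    simp only [hw]
    rw [← Complex.re_sum, ← Matrix.trace_sum, ← Finset.sum_mul, sum_pauliOp_mul_mul_pauliOp, hσ1,
      mul_one, smul_mul_assoc, one_mul, Matrix.trace_smul, smul_eq_mul]
    have : ((2 : ℂ) ^ n) = (((2 : ℝ) ^ n : ℝ) : ℂ) := by push_cast; rfl
    rw [this, Complex.re_ofReal_mul]
  have hq : a.measurement.mixedProb i = ∑ s, 1 / 4 ^ n * w s := by
    rw [← Finset.mul_sum, hsum, POVM.mixedProb, h4, ← hM]
    field_simp
  have hpr : a.prob (pauliChannel p) i = ∑ s, p.1 s * w s := by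
    rw [Step.prob, h, pauliChannel_apply, Finset.sum_mul, Matrix.trace_sum, Complex.re_sum]
    refine Finset.sum_congr rfl fun s _ => ?_
    rw [smul_mul_assoc, Matrix.trace_smul, smul_eq_mul, Complex.re_ofReal_mul]
  rw [hpr, hq, ← Finset.sum_sub_distrib, Finset.mul_sum]
  refine (Finset.abs_sum_le_sum_abs _ _).trans (Finset.sum_le_sum fun s _ => ?_)
  rw [← sub_mul, abs_mul, abs_of_nonneg (hw0 s), ← mul_assoc, mul_one_div]
  exact mul_le_mul_of_nonneg_right (hp s) (hw0 s)

/-! ### The diamond distance of Pauli channels -/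

/-- The vector `(1 ⊗ P)|Ω⟩`, where `|Ω⟩` is the maximally entangled unit vector. -/
noncomputable def bellVec {n : ℕ} (s : PauliLabel n) (a : Qubits n × Qubits n) : ℂ :=
  pauliOp s a.2 a.1 / (√(2 ^ n : ℝ) : ℂ)

lemma star_bellVec_dotProduct {n : ℕ} (s t : PauliLabel n) :
    star (bellVec s) ⬝ᵥ bellVec t = if s = t then 1 else 0 := by
  have h2 : ((√(2 ^ n : ℝ) : ℝ) : ℂ) * ((√(2 ^ n : ℝ) : ℝ) : ℂ) = 2 ^ n := by
    rw [← Complex.ofReal_mul, Real.mul_self_sqrt (by positivity)]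
    push_cast
    rfl
  have h : star (bellVec s) ⬝ᵥ bellVec t =
      (∑ i, ∑ j, star (pauliOp s i j) * pauliOp t i j) / 2 ^ n := by
    simp only [dotProduct, Fintype.sum_prod_type, Pi.star_apply, bellVec, Finset.sum_div]
    rw [Finset.sum_comm]
    refine Finset.sum_congr rfl fun i _ => Finset.sum_congr rfl fun j _ => ?_
    rw [star_div₀, div_mul_div_comm, ← h2]
    simp
  rw [h, sum_star_pauliOp_mul_pauliOp]
  split_ifs <;> simp

/-- An operator that is diagonal in the Bell basis, with real eigenvalues `c`. -/
noncomputable def bellDiag {n : ℕ} (c : PauliLabel n → ℝ) :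
    Matrix (Qubits n × Qubits n) (Qubits n × Qubits n) ℂ :=
  ∑ s, (c s : ℂ) • Matrix.vecMulVec (bellVec s) (star (bellVec s))

lemma bellDiag_mul_bellDiag {n : ℕ} (c e : PauliLabel n → ℝ) :
    bellDiag c * bellDiag e = bellDiag fun s => c s * e s := by
  simp only [bellDiag, Finset.sum_mul, Finset.mul_sum, smul_mul_smul_comm,
    Matrix.vecMulVec_mul_vecMulVec, star_bellVec_dotProduct]
  refine Finset.sum_congr rfl fun s _ => ?_
  rw [Finset.sum_eq_single s]
  · simp
  · intro t _ hts
    rw [if_neg hts, zero_smul, Matrix.vecMulVec_zero, smul_zero]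
  · simp

lemma conjTranspose_bellDiag {n : ℕ} (c : PauliLabel n → ℝ) : (bellDiag c)ᴴ = bellDiag c := by
  simp [bellDiag, Matrix.conjTranspose_sum, Matrix.conjTranspose_smul,
    Matrix.conjTranspose_vecMulVec]

lemma traceNorm_bellDiag {n : ℕ} (c : PauliLabel n → ℝ) :
    traceNorm (bellDiag c) = ∑ s, |c s| := by
  have hpos : (bellDiag fun s => |c s|).PosSemidef := by
    refine Matrix.posSemidef_sum _ fun s _ =>
      (Matrix.posSemidef_vecMulVec_self_star (bellVec s)).smul ?_
    exact_mod_cast abs_nonneg (c s)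
  have hsq : (bellDiag c)ᴴ * bellDiag c =
      (bellDiag fun s => |c s|) * bellDiag fun s => |c s| := by
    rw [conjTranspose_bellDiag, bellDiag_mul_bellDiag, bellDiag_mul_bellDiag]
    simp only [abs_mul_abs_self]
  rw [traceNorm, hsq, CFC.sqrt_mul_self _ hpos.nonneg, bellDiag, Matrix.trace_sum, Complex.re_sum]
  refine Finset.sum_congr rfl fun s _ => ?_
  rw [Matrix.trace_smul, Matrix.trace_vecMulVec, dotProduct_comm, star_bellVec_dotProduct]
  simp

/-- The Choi state of a difference of Pauli channels is Bell-diagonal. -/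
lemma idTensor_sub_bellVec {n : ℕ} (p q : PauliDist n) :
    idTensor (pauliChannel p - pauliChannel q)
        (Matrix.vecMulVec (bellVec fun _ => 0) (star (bellVec fun _ => 0))) =
      bellDiag fun s => p.1 s - q.1 s := by
  have h1 : pauliOp (fun _ : Fin n => (0 : Fin 4)) = 1 := by
    ext i j
    simp [pauliOp, pauli, Matrix.one_apply, Finset.prod_ite_zero, funext_iff]
  ext a b
  have hX : (Matrix.of fun i j : Qubits n =>
      Matrix.vecMulVec (bellVec fun _ => 0) (star (bellVec fun _ => 0)) (a.1, i) (b.1, j)) =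
      Matrix.single a.1 b.1
        ((1 / (√(2 ^ n : ℝ) : ℂ)) * (1 / (√(2 ^ n : ℝ) : ℂ))) := by
    ext i j
    simp only [Matrix.of_apply, Matrix.vecMulVec_apply, Pi.star_apply, bellVec, h1,
      Matrix.one_apply, Matrix.single_apply, eq_comm (a := i), eq_comm (a := j)]
    by_cases hi : a.1 = i <;> by_cases hj : b.1 = j <;> simp [hi, hj]
  have hP : ∀ s : PauliLabel n, star (pauliOp s b.2 b.1) = pauliOp s b.1 b.2 := fun s => by
    rw [← Matrix.conjTranspose_apply, isHermitian_pauliOp]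
  rw [idTensor, Matrix.of_apply, hX]
  simp only [LinearMap.sub_apply, pauliChannel_apply,
    ← Finset.sum_sub_distrib, ← sub_smul, bellDiag, Matrix.sum_apply, Matrix.smul_apply,
    Matrix.vecMulVec_apply, Pi.star_apply, bellVec, star_div₀, hP, Complex.ofReal_sub]
  refine Finset.sum_congr rfl fun s _ => ?_
  congr 1
  rw [Matrix.mul_apply, Finset.sum_eq_single b.1]
  · rw [Matrix.mul_single_apply_same]
    simp
    ring
  · intro c _ hc
    rw [Matrix.mul_single_apply_of_ne _ _ _ _ _ hc, zero_mul]
  · simp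

/-- The diamond norm dominates the `ℓ¹` distance of the Pauli distributions; the maximally
entangled state witnesses this. -/
lemma ofReal_sum_abs_sub_le_diamondNorm {n : ℕ} (p q : PauliDist n) :
    ENNReal.ofReal (∑ s, |p.1 s - q.1 s|) ≤ diamondNorm (pauliChannel p - pauliChannel q) := by
  rw [← traceNorm_bellDiag, ← idTensor_sub_bellVec]
  exact le_iSup₂ (f := fun (φ : Qubits n × Qubits n → ℂ) (_ : star φ ⬝ᵥ φ = 1) =>
    ENNReal.ofReal (traceNorm (idTensor (pauliChannel p - pauliChannel q)
      (Matrix.vecMulVec φ (star φ))))) _ (by rw [star_bellVec_dotProduct, if_pos rfl])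

/-! ### Sums over trees of outcomes -/

/-- If the weights of the branches at each node of an outcome tree of depth `N` sum to at most
`C`, then the weights of the leaves sum to at most `C ^ N`. -/
lemma sum_prod_before_le {K : ℕ} {C : ℝ} (hC : 0 ≤ C) :
    ∀ (N : ℕ) (f : (t : Fin N) → (Fin t → Fin K) → Fin K → ℝ), (∀ t h k, 0 ≤ f t h k) →
      (∀ t h, ∑ k, f t h k ≤ C) →
      ∑ i : Fin N → Fin K, ∏ t, f t (before i t) (i t) ≤ C ^ N
  | 0, f, _, _ => by simp
  | N + 1, f, h0, hf => by
    rw [← (Fin.snocEquiv fun _ : Fin (N + 1) => Fin K).sum_comp, Fintype.sum_prod_type,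
      Finset.sum_comm]
    have key : ∀ (y : Fin N → Fin K) (k : Fin K),
        (∏ t, f t (before ((Fin.snocEquiv fun _ : Fin (N + 1) => Fin K) (k, y)) t)
          ((Fin.snocEquiv fun _ : Fin (N + 1) => Fin K) (k, y) t)) =
        (∏ t : Fin N, f t.castSucc (before y t) (y t)) * f (Fin.last N) y k := by
      intro y k
      rw [Fin.prod_univ_castSucc]
      congr 1
      · refine Finset.prod_congr rfl fun t _ => ?_
        congr 1
        · funext u
          exact Fin.snoc_castSucc (α := fun _ => Fin K) k y ⟨u, u.2.trans t.2⟩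
        · exact Fin.snoc_castSucc (α := fun _ => Fin K) k y t
      · congr 1
        · funext u
          exact Fin.snoc_castSucc (α := fun _ => Fin K) k y u
        · exact Fin.snoc_last (α := fun _ => Fin K) k y
    simp only [key, ← Finset.mul_sum]
    calc ∑ y : Fin N → Fin K, (∏ t : Fin N, f t.castSucc (before y t) (y t)) *
          ∑ k, f (Fin.last N) y k
        ≤ ∑ y : Fin N → Fin K, (∏ t : Fin N, f t.castSucc (before y t) (y t)) * C :=
          Finset.sum_le_sum fun y _ => mul_le_mul_of_nonneg_left (hf (Fin.last N) y)
            (Finset.prod_nonneg fun t _ => h0 _ _ _)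
      _ ≤ C ^ (N + 1) := by
          rw [← Finset.sum_mul, pow_succ]
          exact mul_le_mul_of_nonneg_right
            (sum_prod_before_le hC N (fun t => f t.castSucc) (fun t => h0 t.castSucc)
              fun t => hf t.castSucc) hC

/-- The second moment of a likelihood ratio that is within `δ` of `1`. -/
lemma sum_sq_div_le {ι : Type*} [Fintype ι] {p q : ι → ℝ} {δ : ℝ} (hq0 : ∀ i, 0 ≤ q i)
    (hp : ∑ i, p i = 1) (hq : ∑ i, q i = 1) (h : ∀ i, |p i - q i| ≤ δ * q i) :
    ∑ i, p i ^ 2 / q i ≤ 1 + δ ^ 2 := by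
  have key : ∀ i, p i ^ 2 / q i ≤ 2 * p i - q i + δ ^ 2 * q i := by
    intro i
    rcases (hq0 i).eq_or_lt with h0 | h0
    · have := h i
      rw [← h0, mul_zero, sub_zero] at this
      simp [← h0, abs_nonpos_iff.mp this]
    · rw [div_le_iff₀ h0]
      have := sq_le_sq' (abs_le.mp (h i)).1 (abs_le.mp (h i)).2
      nlinarith
  calc ∑ i, p i ^ 2 / q i ≤ ∑ i, (2 * p i - q i + δ ^ 2 * q i) :=
        Finset.sum_le_sum fun i _ => key i
    _ = 1 + δ ^ 2 := by
        rw [Finset.sum_add_distrib, Finset.sum_sub_distrib, ← Finset.mul_sum, ← Finset.mul_sum,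
          hp, hq]
        ring

/-! ### The hard family of Pauli channels -/

/-- The sign `±1` of a bit. -/
def bitSign (b : Bool) : ℝ := if b then 1 else -1

lemma abs_bitSign (b : Bool) : |bitSign b| = 1 := by cases b <;> simp [bitSign]

/-- Given a pairing `e` of the Pauli operators, the distribution that gives the two members of
the `j`-th pair the weights `(1 + δ) / 4 ^ n` and `(1 - δ) / 4 ^ n`, the bit `x j` telling which
of them is the heavier one. -/
noncomputable def hardDist {n m : ℕ} (e : PauliLabel n ≃ Fin m × Bool) {δ : ℝ} (h0 : 0 ≤ δ)
    (h1 : δ ≤ 1) (x : Fin m → Bool) : PauliDist n :=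
  ⟨fun s => (1 + δ * (bitSign (x (e s).1) * bitSign (e s).2)) / 4 ^ n, fun s => by
    have h : |δ * (bitSign (x (e s).1) * bitSign (e s).2)| ≤ 1 := by
      rw [abs_mul, abs_mul, abs_bitSign, abs_bitSign, abs_of_nonneg h0]
      linarith
    have := (abs_le.mp h).1
    exact div_nonneg (by linarith) (by positivity), by
    have hcard : Fintype.card (PauliLabel n) = 4 ^ n := by simp
    rw [← Finset.sum_div, Finset.sum_add_distrib, ← Finset.mul_sum,
      e.sum_comp (fun z => bitSign (x z.1) * bitSign z.2), Fintype.sum_prod_type]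
    simp [bitSign]⟩

lemma abs_hardDist_sub_le {n m : ℕ} (e : PauliLabel n ≃ Fin m × Bool) {δ : ℝ} (h0 : 0 ≤ δ)
    (h1 : δ ≤ 1) (x : Fin m → Bool) (s : PauliLabel n) :
    |(hardDist e h0 h1 x).1 s - 1 / 4 ^ n| ≤ δ / 4 ^ n := by
  rw [hardDist, ← sub_div, abs_div, add_sub_cancel_left, abs_mul, abs_mul, abs_bitSign,
    abs_bitSign, abs_of_nonneg h0, abs_of_pos (by positivity : (0 : ℝ) < 4 ^ n)]
  simp

/-- An approximation `q` of `hardDist e h0 h1 x` in `ℓ¹` determines most of the bits of `x`: the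
guess compares the weights of the two members of each pair. -/
lemma card_ne_mul_le_sum_abs {n m : ℕ} (e : PauliLabel n ≃ Fin m × Bool) {δ : ℝ} (h0 : 0 ≤ δ)
    (h1 : δ ≤ 1) (x : Fin m → Bool) (q : PauliLabel n → ℝ) :
    ((Finset.univ.filter fun j =>
        x j ≠ decide (q (e.symm (j, false)) ≤ q (e.symm (j, true)))).card : ℝ) *
      (2 * δ / 4 ^ n) ≤ ∑ s, |(hardDist e h0 h1 x).1 s - q s| := by
  rw [← e.symm.sum_comp, Fintype.sum_prod_type, ← nsmul_eq_mul, ← Finset.sum_const,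
    Finset.sum_filter]
  refine Finset.sum_le_sum fun j _ => ?_
  rw [Fintype.sum_bool]
  split_ifs with hj
  · have hpos : 0 ≤ δ / 4 ^ n := by positivity
    simp only [hardDist, Equiv.apply_symm_apply]
    generalize q (e.symm (j, false)) = u at *
    generalize q (e.symm (j, true)) = v at *
    have e1 : ∀ z : ℝ, (1 + δ * z) / 4 ^ n = 1 / 4 ^ n + δ / 4 ^ n * z := fun z => by ring
    rw [e1, e1, mul_div_assoc]
    have a1 := le_abs_self (1 / 4 ^ n + δ / 4 ^ n * (bitSign (x j) * bitSign true) - v)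
    have a2 := neg_abs_le (1 / 4 ^ n + δ / 4 ^ n * (bitSign (x j) * bitSign true) - v)
    have a3 := le_abs_self (1 / 4 ^ n + δ / 4 ^ n * (bitSign (x j) * bitSign false) - u)
    have a4 := neg_abs_le (1 / 4 ^ n + δ / 4 ^ n * (bitSign (x j) * bitSign false) - u)
    cases hx : x j <;> simp [hx, bitSign] at hj a1 a2 a3 a4 ⊢ <;> linarith
  · positivity

/-- A Chernoff bound: few bit strings of length `m` agree with a given one in at least three
quarters of the places. -/
lemma card_hamming_le {m : ℕ} (y : Fin m → Bool) :
    ((Finset.univ.filter fun x : Fin m → Bool =>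
      4 * (Finset.univ.filter fun j => x j ≠ y j).card ≤ m).card : ℝ) ≤
      4 ^ (m / 4) * (5 / 4) ^ m := by
  have hgen : ∑ x : Fin m → Bool, (1 / 4 : ℝ) ^ (Finset.univ.filter fun j => x j ≠ y j).card =
      (5 / 4) ^ m := by
    have h : ∀ x : Fin m → Bool, (1 / 4 : ℝ) ^ (Finset.univ.filter fun j => x j ≠ y j).card =
        ∏ j, if x j ≠ y j then (1 / 4 : ℝ) else 1 := fun x => by
      rw [Finset.prod_ite, Finset.prod_const, Finset.prod_const_one, mul_one]
    simp only [h]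
    have h2 := Finset.prod_univ_sum (fun _ : Fin m => (Finset.univ : Finset Bool))
      (fun j b => if b ≠ y j then (1 / 4 : ℝ) else 1)
    rw [Fintype.piFinset_univ] at h2
    rw [← h2]
    have h3 : ∀ j, ∑ b, (if b ≠ y j then (1 / 4 : ℝ) else 1) = 5 / 4 := fun j => by
      cases y j <;> simp <;> norm_num
    simp only [h3, Finset.prod_const, Finset.card_univ, Fintype.card_fin]
  rw [← hgen, Finset.mul_sum, Finset.card_filter, Nat.cast_sum]
  refine Finset.sum_le_sum fun x _ => ?_
  split_ifs with hx
  · have hle : (Finset.univ.filter fun j => x j ≠ y j).card ≤ m / 4 := by omega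
    rw [one_div, inv_pow, ← div_eq_mul_inv, le_div_iff₀ (by positivity)]
    simpa using pow_le_pow_right₀ (by norm_num : (1 : ℝ) ≤ 4) hle
  · simp only [Nat.cast_zero]
    positivity

/-! ### Success probabilities on the hard family -/

lemma Strategy.prob_nonneg {n N : ℕ} (S : Strategy n N) (p : PauliDist n)
    (i : Fin N → Fin S.K) : 0 ≤ S.prob p i :=
  Finset.prod_nonneg fun _ _ => Step.prob_nonneg _ _ _

lemma Strategy.successProb_nonneg {n N : ℕ} (S : Strategy n N) (ε : ℝ) (p : PauliDist n) :
    0 ≤ S.successProb ε p := by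
  refine Finset.sum_nonneg fun i _ => ?_
  split_ifs
  exacts [S.prob_nonneg p i, le_rfl]

/-- The law of the outcomes when every measurement is made on the maximally mixed state, which is
the law under the completely depolarizing channel. -/
noncomputable def Strategy.mixedProb {n N : ℕ} (S : Strategy n N) (i : Fin N → Fin S.K) : ℝ :=
  ∏ t, (S.step t (before i t)).measurement.mixedProb (i t)

lemma Strategy.mixedProb_nonneg {n N : ℕ} (S : Strategy n N) (i : Fin N → Fin S.K) :
    0 ≤ S.mixedProb i :=
  Finset.prod_nonneg fun _ _ => POVM.mixedProb_nonneg _ _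

lemma Strategy.sum_mixedProb_le {n N : ℕ} (S : Strategy n N) : ∑ i, S.mixedProb i ≤ 1 := by
  refine (sum_prod_before_le zero_le_one N
    (fun t h k => (S.step t h).measurement.mixedProb k)
    (fun _ _ _ => POVM.mixedProb_nonneg _ _) fun _ _ => (POVM.sum_mixedProb _).le).trans ?_
  rw [one_pow]

section NearUniform

variable {n N : ℕ} (S : Strategy n N) (p : PauliDist n) {δ : ℝ}

lemma Strategy.sum_prob_sq_div_le (hp : ∀ s, |p.1 s - 1 / 4 ^ n| ≤ δ / 4 ^ n) :
    ∑ i, S.prob p i ^ 2 / S.mixedProb i ≤ (1 + δ ^ 2) ^ N := by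
  simp only [Strategy.prob, Strategy.mixedProb, ← Finset.prod_pow, ← Finset.prod_div_distrib]
  exact sum_prod_before_le (by positivity) N
    (fun t h k => (S.step t h).prob (pauliChannel p) k ^ 2 /
      (S.step t h).measurement.mixedProb k)
    (fun _ _ _ => div_nonneg (sq_nonneg _) (POVM.mixedProb_nonneg _ _))
    fun t h => sum_sq_div_le (POVM.mixedProb_nonneg _) (Step.sum_prob _ _)
      (POVM.sum_mixedProb _) (Step.abs_prob_sub_mixedProb_le _ _ hp)

lemma Strategy.prob_eq_zero_of_mixedProb_eq_zero (hp : ∀ s, |p.1 s - 1 / 4 ^ n| ≤ δ / 4 ^ n)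
    {i : Fin N → Fin S.K} (hi : S.mixedProb i = 0) : S.prob p i = 0 := by
  obtain ⟨t, ht, h⟩ := Finset.prod_eq_zero_iff.mp hi
  have := (S.step t (before i t)).abs_prob_sub_mixedProb_le p hp (i t)
  rw [h, mul_zero, sub_zero] at this
  exact Finset.prod_eq_zero ht (abs_nonpos_iff.mp this)

end NearUniform

/-- Whatever the outcomes, the estimate is `ε`-close to only a small fraction of the channels in
the hard family. -/
lemma card_diamondNorm_le {n m : ℕ} (hm : 2 * m = 4 ^ n) (e : PauliLabel n ≃ Fin m × Bool) {ε : ℝ}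
    (hε : 0 < ε) (h0 : 0 ≤ 4 * ε) (h1 : 4 * ε ≤ 1) (q : PauliDist n)
    [DecidablePred fun x : Fin m → Bool =>
      diamondNorm (pauliChannel (hardDist e h0 h1 x) - pauliChannel q) ≤ ENNReal.ofReal ε] :
    ((Finset.univ.filter fun x : Fin m → Bool =>
      diamondNorm (pauliChannel (hardDist e h0 h1 x) - pauliChannel q) ≤
        ENNReal.ofReal ε).card : ℝ) ≤ 4 ^ (m / 4) * (5 / 4) ^ m := by
  refine le_trans ?_ (card_hamming_le fun j =>
    decide (q.1 (e.symm (j, false)) ≤ q.1 (e.symm (j, true))))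
  refine Nat.cast_le.mpr (Finset.card_le_card fun x hx => ?_)
  simp only [Finset.mem_filter, Finset.mem_univ, true_and] at hx ⊢
  have h := (ENNReal.ofReal_le_ofReal_iff hε.le).mp
    ((ofReal_sum_abs_sub_le_diamondNorm _ _).trans hx)
  have h2 := (card_ne_mul_le_sum_abs e h0 h1 x q.1).trans h
  have hmR : (4 : ℝ) ^ n = 2 * m := by exact_mod_cast hm.symm
  have hmpos : (0 : ℝ) < m := by
    have : (0 : ℝ) < 4 ^ n := by positivity
    linarith
  rw [hmR, mul_div_assoc', div_le_iff₀ (by positivity)] at h2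
  have h3 : ε * (4 * ((Finset.univ.filter fun j =>
      x j ≠ decide (q.1 (e.symm (j, false)) ≤ q.1 (e.symm (j, true)))).card : ℝ)) ≤ ε * m := by
    linarith
  exact_mod_cast le_of_mul_le_mul_left h3 hε

/-- The second-moment bound: by the Cauchy-Schwarz inequality, the average success probability
on the hard family is controlled by the second moment of the likelihood ratios with respect to
the depolarized process and by the chance of success of a blind guess. -/
lemma Strategy.sq_sum_successProb_le {n N m : ℕ} (S : Strategy n N) (hm : 2 * m = 4 ^ n)
    (e : PauliLabel n ≃ Fin m × Bool) {ε : ℝ} (hε : 0 < ε) (h0 : 0 ≤ 4 * ε) (h1 : 4 * ε ≤ 1) :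
    (∑ x, S.successProb ε (hardDist e h0 h1 x)) ^ 2 ≤
      2 ^ m * (1 + (4 * ε) ^ 2) ^ N * (4 ^ (m / 4) * (5 / 4) ^ m) := by
  classical
  set P : (Fin m → Bool) × (Fin N → Fin S.K) → Prop := fun z =>
    diamondNorm (pauliChannel (hardDist e h0 h1 z.1) - pauliChannel (S.estimate z.2)) ≤
      ENNReal.ofReal ε with hP
  have hlhs : ∑ x, S.successProb ε (hardDist e h0 h1 x) =
      ∑ z, if P z then S.prob (hardDist e h0 h1 z.1) z.2 else 0 := by
    rw [Fintype.sum_prod_type]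
    refine Finset.sum_congr rfl fun x _ => Finset.sum_congr rfl fun i _ => ?_
    simp only [hP]
  have hCS := Finset.sum_sq_le_sum_mul_sum_of_sq_le_mul Finset.univ
    (r := fun z => if P z then S.prob (hardDist e h0 h1 z.1) z.2 else 0)
    (f := fun z => S.prob (hardDist e h0 h1 z.1) z.2 ^ 2 / S.mixedProb z.2)
    (g := fun z => if P z then S.mixedProb z.2 else 0)
    (fun z _ => div_nonneg (sq_nonneg _) (S.mixedProb_nonneg _))
    (fun z _ => by split_ifs; exacts [S.mixedProb_nonneg _, le_rfl])
    (fun z _ => by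
      split_ifs
      · by_cases hz : S.mixedProb z.2 = 0
        · rw [S.prob_eq_zero_of_mixedProb_eq_zero _ (abs_hardDist_sub_le e h0 h1 z.1) hz, hz]
          simp
        · rw [div_mul_cancel₀ _ hz]
      · simp)
  rw [hlhs]
  refine hCS.trans (mul_le_mul ?_ ?_ (Finset.sum_nonneg fun z _ => ?_) (by positivity))
  · rw [Fintype.sum_prod_type]
    calc ∑ x, ∑ i, S.prob (hardDist e h0 h1 x) i ^ 2 / S.mixedProb i
        ≤ ∑ _x : Fin m → Bool, (1 + (4 * ε) ^ 2) ^ N := Finset.sum_le_sum fun x _ =>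
          S.sum_prob_sq_div_le _ (abs_hardDist_sub_le e h0 h1 x)
      _ = 2 ^ m * (1 + (4 * ε) ^ 2) ^ N := by simp
  · rw [Fintype.sum_prod_type_right]
    calc ∑ i, ∑ x, (if P (x, i) then S.mixedProb i else 0)
        = ∑ i, ((Finset.univ.filter fun x => P (x, i)).card : ℝ) * S.mixedProb i := by
          refine Finset.sum_congr rfl fun i _ => ?_
          rw [← Finset.sum_filter, Finset.sum_const, nsmul_eq_mul]
      _ ≤ ∑ i, (4 ^ (m / 4) * (5 / 4) ^ m) * S.mixedProb i := Finset.sum_le_sum fun i _ =>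
          mul_le_mul_of_nonneg_right (card_diamondNorm_le hm e hε h0 h1 (S.estimate i))
            (S.mixedProb_nonneg i)
      _ ≤ 4 ^ (m / 4) * (5 / 4) ^ m := by
          rw [← Finset.mul_sum]
          exact mul_le_of_le_one_right (by positivity) S.sum_mixedProb_le
  · split_ifs
    exacts [S.mixedProb_nonneg _, le_rfl]

/-- A bound on the total success probability over a finite family of channels that holds for
every value of the seed holds for the randomized strategy. No measurability in the seed is
needed, since the lower integral of an arbitrary function is superadditive. -/
lemma IsOneThirdCorrect.two_thirds_mul_card_le {Ω : Type*} [MeasurableSpace Ω] {μ : Measure Ω}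
    [IsProbabilityMeasure μ] {n N : ℕ} {S : Ω → Strategy n N} {ε : ℝ}
    (hS : IsOneThirdCorrect μ S ε) {ι : Type*} [Fintype ι] (p : ι → PauliDist n) {B : ℝ}
    (hB0 : 0 ≤ B) (hB : ∀ ω, ∑ x, (S ω).successProb ε (p x) ≤ B) :
    2 / 3 * (Fintype.card ι : ℝ) ≤ B := by
  have hsuper : ∀ s : Finset ι,
      ∑ x ∈ s, ∫⁻ ω, ENNReal.ofReal ((S ω).successProb ε (p x)) ∂μ ≤
        ∫⁻ ω, ∑ x ∈ s, ENNReal.ofReal ((S ω).successProb ε (p x)) ∂μ := by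
    classical
    intro s
    induction s using Finset.induction_on with
    | empty => simp
    | insert a s ha ih =>
      simp only [Finset.sum_insert ha]
      exact (add_le_add le_rfl ih).trans (le_lintegral_add _ _)
  have h : (Fintype.card ι : ENNReal) * (2 / 3) ≤ ENNReal.ofReal B :=
    calc (Fintype.card ι : ENNReal) * (2 / 3) = ∑ _x : ι, (2 / 3 : ENNReal) := by simp
      _ ≤ ∑ x, ∫⁻ ω, ENNReal.ofReal ((S ω).successProb ε (p x)) ∂μ :=
          Finset.sum_le_sum fun x _ => hS (p x)
      _ ≤ ∫⁻ ω, ∑ x, ENNReal.ofReal ((S ω).successProb ε (p x)) ∂μ := hsuper _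
      _ ≤ ∫⁻ _, ENNReal.ofReal B ∂μ := lintegral_mono fun ω => by
          rw [← ENNReal.ofReal_sum_of_nonneg fun x _ => (S ω).successProb_nonneg ε (p x)]
          exact ENNReal.ofReal_le_ofReal (hB ω)
      _ = ENNReal.ofReal B := by simp
  have h2 := ENNReal.toReal_mono ENNReal.ofReal_ne_top h
  rw [ENNReal.toReal_ofReal hB0, ENNReal.toReal_mul] at h2
  simp at h2
  linarith

/-- The chance of success of a blind guess stays below `4 / 9 = (2 / 3) ^ 2` and decays
exponentially. The values `m = 4 ^ n / 2` are `2` and multiples of `8`. -/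
lemma four_pow_mul_five_eighths_pow_le {m k : ℕ} (hm : m = 2 * 4 ^ k) :
    (4 : ℝ) ^ (m / 4) * (5 / 8) ^ m ≤ 4 / 9 * Real.exp (-(m / 100)) := by
  rcases k with _ | k
  · have hm2 : m = 2 := by simpa using hm
    subst hm2
    have := Real.add_one_le_exp (-(((2 : ℕ) : ℝ) / 100))
    norm_num at this ⊢
    linarith
  · obtain ⟨j, hj⟩ : ∃ j, m = 4 * (j + 2) := by
      have : 0 < 4 ^ k := by positivity
      exact ⟨2 * 4 ^ k - 2, by rw [hm, pow_succ]; omega⟩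
    subst hj
    have hdiv : 4 * (j + 2) / 4 = j + 2 := by omega
    have hexp : Real.exp (-(((4 * (j + 2) : ℕ) : ℝ) / 100)) =
        Real.exp (-(1 / 25)) ^ (j + 2) := by
      rw [← Real.exp_nat_mul]
      congr 1
      push_cast
      ring
    have h24 : (24 / 25 : ℝ) ≤ Real.exp (-(1 / 25)) := by
      have := Real.add_one_le_exp (-(1 / 25 : ℝ))
      linarith
    rw [hdiv, hexp, pow_mul, ← mul_pow]
    calc (4 * (5 / 8) ^ 4 : ℝ) ^ (j + 2) = (4 * (5 / 8) ^ 4) ^ 2 * (4 * (5 / 8) ^ 4) ^ j := by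
          ring
      _ ≤ (4 / 9 * (24 / 25) ^ 2) * (24 / 25) ^ j := by
          gcongr <;> norm_num
      _ = 4 / 9 * (24 / 25) ^ (j + 2) := by ring
      _ ≤ 4 / 9 * Real.exp (-(1 / 25)) ^ (j + 2) := by gcongr

end PauliTomography

theorem mainTheorem3 :
    ∃ c : ℝ, 0 < c ∧
      ∀ (n : ℕ), 1 ≤ n → ∀ (ε : ℝ), 0 < ε → ε ≤ 1 / 4 →
      ∀ (N : ℕ) {Ω : Type*} [MeasurableSpace Ω] (μ : Measure Ω) [IsProbabilityMeasure μ]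
        (S : Ω → PauliTomography.Strategy n N),
        PauliTomography.IsOneThirdCorrect μ S ε →
        c * (((2 : ℝ) ^ n) ^ 2 / ε ^ 2) ≤ (N : ℝ) := by
  open PauliTomography in
  refine ⟨1 / 3200, by norm_num, fun n hn ε hε hε4 N Ω _ μ _ S hS => ?_⟩
  obtain ⟨k, rfl⟩ : ∃ k, n = k + 1 := ⟨n - 1, by omega⟩
  obtain ⟨m, hmk⟩ : ∃ m, m = 2 * 4 ^ k := ⟨_, rfl⟩
  have hm : 2 * m = 4 ^ (k + 1) := by rw [hmk, pow_succ]; ring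
  have h0 : 0 ≤ 4 * ε := by positivity
  have h1 : 4 * ε ≤ 1 := by linarith
  have e : PauliLabel (k + 1) ≃ Fin m × Bool :=
    Fintype.equivOfCardEq (by simp [← hm, mul_comm])
  have hpos : (0 : ℝ) ≤ 2 ^ m * (1 + (4 * ε) ^ 2) ^ N * (4 ^ (m / 4) * (5 / 4) ^ m) := by
    positivity
  have hav := hS.two_thirds_mul_card_le (fun x => hardDist e h0 h1 x) (Real.sqrt_nonneg _)
    fun ω => Real.le_sqrt_of_sq_le ((S ω).sq_sum_successProb_le hm e hε h0 h1)
  have hsq := (Real.le_sqrt (by positivity) hpos).mp hav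
  have hcard : (Fintype.card (Fin m → Bool) : ℝ) = 2 ^ m := by simp
  have hsplit : (5 / 4 : ℝ) ^ m = 2 ^ m * (5 / 8) ^ m := by rw [← mul_pow]; norm_num
  have h2m : (0 : ℝ) < 2 ^ m * 2 ^ m := by positivity
  -- Dividing by the square of the size of the family leaves the bound for the average.
  have hmain : (4 / 9 : ℝ) ≤ (1 + (4 * ε) ^ 2) ^ N * (4 ^ (m / 4) * (5 / 8) ^ m) := by
    rw [hcard, hsplit] at hsq
    refine le_of_mul_le_mul_left ?_ h2m
    linarith
  have hgrow : (1 + (4 * ε) ^ 2) ^ N ≤ Real.exp (N * (4 * ε) ^ 2) := by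
    rw [Real.exp_nat_mul]
    gcongr
    linarith [Real.add_one_le_exp ((4 * ε) ^ 2)]
  have hexp : Real.exp 0 ≤ Real.exp (N * (4 * ε) ^ 2 + -(m / 100)) := by
    rw [Real.exp_add, Real.exp_zero]
    have := hmain.trans (mul_le_mul hgrow (four_pow_mul_five_eighths_pow_le hmk) (by positivity)
      (Real.exp_pos _).le)
    linarith
  have hfin := Real.exp_le_exp.mp hexp
  have hd : ((2 : ℝ) ^ (k + 1)) ^ 2 = 2 * m := by
    rw [← pow_mul, mul_comm, pow_mul]
    norm_num
    exact_mod_cast hm.symm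
  rw [hd, ← mul_div_assoc, div_le_iff₀ (by positivity)]
  linarith
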